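/- **Setting.** Let $K\ge 2$ arms, a horizon $T\ge 1$, $\sigma,\hat\sigma>0$, $\Delta>0$ and $\bar\Delta\in[2\Delta,+\infty]$ be given, together with known measurable mappings $\phi_k:\mathbb R\to\mathbb R$, classes $\mathcal V^{\mathrm{aux}}_k$ of allowed laws of auxiliary observations ($k=1,\dots,K$), and an information arrival matrix $H=(h_{k,t})$ of nonnegative integers, $1\le k\le K$, $1\le t\le T$. Assume that Gaussian auxiliary feedback is allowed: for every arm $k$ and every $a\in\mathbb R$ some $\rho\in\mathcal V^{\mathrm{aux}}_k$ is such that $\phi_k(Y)\sim\mathcal N(a,\hat\sigma^2)$ when $Y\sim\rho$. A problem $(\nu,\nu^{\mathrm{aux}})$ consists, for each arm $k$, of a reward law $\nu_k$ on $\mathbb R$ that is $\sigma^2$-sub-Gaussian, i.e. $\mathbb E\,e^{\lambda(X-\mathbb EX)}\le e^{\sigma^2\lambda^2/2}$ for all $\lambda\in\mathbb R$, with mean $\mu_k$, and of a law $\nu^{\mathrm{aux}}_k\in\mathcal V^{\mathrm{aux}}_k$ such that, for $Y\sim\nu_k^{\mathrm{aux}}$, $\phi_k(Y)$ is $\hat\sigma^2$-sub-Gaussian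 with $\mathbb E[\phi_k(Y)]=\mu_k$. Let $\mu^*=\max_k\mu_k$ and let $\mathcal S$ be the class of problems with a best arm $k^*$ such that $\Delta\le\mu^*-\mu_k\le\bar\Delta$ for all $k\ne k^*$ (for $\bar\Delta=+\infty$ there is no upper bound on the gaps). If arm $k$ is selected at epoch $t$, the reward $X_{k,t}\sim\nu_k$ is collected. Just before epoch $t$, $h_{k,t}$ auxiliary observations $Y_{k,t,m}\sim\nu_k^{\mathrm{aux}}$ on each arm $k$ arrive. All rewards and auxiliary observations are independent. Put $Z_{k,t}=\sum_{m=1}^{h_{k,t}}\phi_k(Y_{k,t,m})/\max\{1,h_{k,t}\}$. An admissible policy $\pi$ selects at each epoch $t$ an arm $\pi_t$ that is a measurable function of the previously collected rewards $X_{\pi_s,s}$, $s<t$, of $Z_{k,s}$ and $h_{k,s}$ for all $k$ and $s\le t$, and of a private random element $U$ independent of everything else. Its worst-case regret is $$\mathcal R^\pi_{\mathcal S}(H,T)=\sup_{(\nu,\nu^{\mathrm{aux}})\in\mathcal S}\ \mathbb E^\pi_{\nu,\nu^{\mathrm{aux}}}\Big[\sum_{t=1}^T(\mu^*-\mu_{\pi_t})\Big]\in[0,+\infty].$$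 **Theorem.** For all $\sigma,\hat\sigma>0$ there are positive constants $C_1,C_2,C_3$, depending only on $\sigma$ and $\hat\sigma$, such that for all $K$, $T$, $\Delta$, $\bar\Delta$, $(\phi_k)$, $(\mathcal V^{\mathrm{aux}}_k)$ and $H$ as above and every admissible policy $\pi$, $$\mathcal R^\pi_{\mathcal S}(H,T)\ \ge\ \frac{C_1}{\Delta}\sum_{k=1}^K\log\Big(\frac{C_2\Delta^2}{K}\sum_{t=1}^T\exp\Big(-C_3\Delta^2\sum_{s=1}^t h_{k,s}\Big)\Big).$$ -/

import Mathlib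

open MeasureTheory ProbabilityTheory
open scoped NNReal

namespace AuxBandit

/-- The centred random variable `f - E f` is `c`-sub-Gaussian under the probability law `ν`:
`E exp (l (f - E f)) ≤ exp (c l ^ 2 / 2)` for every real `l`, all exponential moments being
finite. -/
def IsSubGaussian (f : ℝ → ℝ) (c : ℝ≥0) (ν : ProbabilityMeasure ℝ) : Prop :=
  HasSubgaussianMGF (fun x => f x - ∫ y, f y ∂(ν : Measure ℝ)) c (ν : Measure ℝ)

/-- The mean of a law on the real line. -/
noncomputable def mean (ν : ProbabilityMeasure ℝ) : ℝ := ∫ x, x ∂(ν : Measure ℝ)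

/-- The largest mean reward of a reward profile. -/
noncomputable def bestMean {K : ℕ} (ν : Fin K → ProbabilityMeasure ℝ) : ℝ := ⨆ j, mean (ν j)

/-- The difference between the largest mean reward and the mean reward of arm `k`. -/
noncomputable def gap {K : ℕ} (ν : Fin K → ProbabilityMeasure ℝ) (k : Fin K) : ℝ :=
  bestMean ν - mean (ν k)

/-- The class of problems, i.e. of pairs (reward laws, auxiliary laws), when the mappings `φ k`
are known, `Vaux k` is the class of allowed laws of the auxiliary observations on arm `k`,
the gaps of the suboptimal arms are at least `Δ`, and all gaps are at most `Δmax`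
(`Δmax = ⊤` is the class without an upper bound on the gaps). -/
structure IsProblem {K : ℕ} (σ σaux : ℝ≥0) (φ : Fin K → ℝ → ℝ)
    (Vaux : Fin K → Set (ProbabilityMeasure ℝ)) (Δ : ℝ) (Δmax : EReal)
    (p : (Fin K → ProbabilityMeasure ℝ) × (Fin K → ProbabilityMeasure ℝ)) : Prop where
  /-- every reward law is `σ ^ 2`-sub-Gaussian -/
  reward_subGaussian : ∀ k, IsSubGaussian id (σ ^ 2) (p.1 k)
  /-- every auxiliary law is an allowed one -/
  aux_mem : ∀ k, p.2 k ∈ Vaux k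
  /-- the mapped auxiliary observations are `σaux ^ 2`-sub-Gaussian -/
  aux_subGaussian : ∀ k, IsSubGaussian (φ k) (σaux ^ 2) (p.2 k)
  /-- the mapped auxiliary observations are unbiased for the mean reward -/
  aux_mean : ∀ k, ∫ y, φ k y ∂(p.2 k : Measure ℝ) = mean (p.1 k)
  /-- there is a best arm, and every other arm has gap at least `Δ` -/
  gap_ge : ∃ kstar, gap p.1 kstar = 0 ∧ ∀ k, k ≠ kstar → Δ ≤ gap p.1 k
  /-- the gaps are bounded by `Δmax` -/
  gap_le : ∀ k, ((gap p.1 k : ℝ) : EReal) ≤ Δmax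

/-- What a policy observes before its decision at epoch `t`: the rewards it collected at the
epochs before `t`, the vectors of averaged mapped auxiliary observations up to `t`, and the
numbers of information arrivals up to `t`. -/
abbrev History (K T : ℕ) (t : Fin T) : Type :=
  (Set.Iio t → ℝ) × (Set.Iic t → Fin K → ℝ) × (Set.Iic t → Fin K → ℕ)

/-- Admissible policies with `K` arms and horizon `T`: a probability space for the private
randomization and, for every epoch, a measurable decision rule. -/
structure Policy (K T : ℕ) where
  /-- the sample space of the private randomization -/
  U : Type*
  /-- its measurable sets -/
  [mU : MeasurableSpace U]
  /-- its law -/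
  law : Measure U
  [isProb : IsProbabilityMeasure law]
  /-- the decision rule at epoch `t` -/
  rule : (t : Fin T) → History K T t × U → Fin K
  measurable_rule : ∀ t, Measurable (rule t)

attribute [instance] Policy.mU Policy.isProb

variable {K T : ℕ}

/-- The auxiliary observations: `y t k m` is the `m`-th of the `H k t` observations on arm `k`
that arrive just before epoch `t`. -/
abbrev AuxTable (H : Fin K → Fin T → ℕ) : Type :=
  (t : Fin T) → (k : Fin K) → Fin (H k t) → ℝ

/-- The average of the mapped auxiliary observations on arm `k` just before epoch `t`
(zero if there are none). -/
noncomputable def auxAverage (φ : Fin K → ℝ → ℝ) (H : Fin K → Fin T → ℕ) (y : AuxTable H)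
    (t : Fin T) (k : Fin K) : ℝ :=
  (∑ m, φ k (y t k m)) / ((max 1 (H k t) : ℕ) : ℝ)

/-- The arm that the policy selects at epoch `t`, where `x s k` is the reward that arm `k` yields
at epoch `s` if it is selected then, `z s k` the average auxiliary feedback, and `u` the private
randomization. -/
noncomputable def action (π : Policy K T) (H : Fin K → Fin T → ℕ) (u : π.U)
    (x z : Fin T → Fin K → ℝ) (t : Fin T) : Fin K :=
  π.rule t ((fun s => x s.1 (action π H u x z s.1), fun s => z s.1, fun s k => H k s.1), u)
termination_by t
decreasing_by exact s.2

/-- The joint law of the private randomization, of the rewards and of the auxiliary observations: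
all of them are independent, the rewards of arm `k` have law `ν k` and the auxiliary observations
on arm `k` have law `νaux k`. -/
noncomputable def sampleLaw (π : Policy K T) (H : Fin K → Fin T → ℕ)
    (p : (Fin K → ProbabilityMeasure ℝ) × (Fin K → ProbabilityMeasure ℝ)) :
    Measure (π.U × (Fin T → Fin K → ℝ) × AuxTable H) :=
  π.law.prod
    ((Measure.pi fun _ : Fin T => Measure.pi fun k => (p.1 k : Measure ℝ)).prod
      (Measure.pi fun t => Measure.pi fun k => Measure.pi fun _ : Fin (H k t) =>
        (p.2 k : Measure ℝ)))

/-- The expected regret of a policy in a given problem. -/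
noncomputable def regret (φ : Fin K → ℝ → ℝ) (H : Fin K → Fin T → ℕ) (π : Policy K T)
    (p : (Fin K → ProbabilityMeasure ℝ) × (Fin K → ProbabilityMeasure ℝ)) : ℝ :=
  ∫ ω, ∑ t, (bestMean p.1 - mean (p.1 (action π H ω.1 ω.2.1 (auxAverage φ H ω.2.2) t)))
    ∂(sampleLaw π H p)

/-- The worst-case regret of a policy over the class of problems. -/
noncomputable def worstCaseRegret (σ σaux : ℝ≥0) (φ : Fin K → ℝ → ℝ)
    (Vaux : Fin K → Set (ProbabilityMeasure ℝ)) (Δ : ℝ) (Δmax : EReal)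
    (H : Fin K → Fin T → ℕ) (π : Policy K T) : EReal :=
  ⨆ p : {p // IsProblem σ σaux φ Vaux Δ Δmax p}, ((regret φ H π p.1 : ℝ) : EReal)

end AuxBandit

/-!
The lower bound is a two-point testing argument, played simultaneously over the arms, with Gaussian
rewards and Gaussian mapped auxiliary observations. Let `S k` be the sum of exponentials in the
logarithm that belongs to arm `k`, and let `b` be an arm with the smallest `S`. In the base problem
arm `b` has mean `Δ` and all other arms have mean `0`; in the alternative problem of an arm `k ≠ b`
the mean of arm `k` is raised to `2 Δ`, which makes it the best arm by a margin `Δ`. Let `n k` be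
the expected number of selections of arm `k` in the base problem.

*Testing.* A policy sees arm `k` only through the rewards it collected there and the auxiliary
observations that have arrived, so the log-likelihood ratio between the two problems at epoch `t`
has mean at least `-(c Δ² n k + C₃ Δ² ∑_{s ≤ t} h_{k,s})`. Hence selecting `k` in the base problem
and not selecting it in the alternative problem have probabilities that sum up to at least
`exp (-1 - c Δ² n k - C₃ Δ² ∑_{s ≤ t} h_{k,s})` (`exp_le_choice_add_choice_ne`).

The sample space holds the rewards of all arms at all epochs, also those that are never collected.
The likelihood ratio of the full tables is useless, since its logarithm has mean of order `-Δ² T`.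
`Resampling.setLIntegral_observed` discards the factors of the unobserved coordinates: if a
coordinate is unobserved, then redrawing it changes neither the event of interest nor the set of
observed coordinates, so that its factor can be integrated out, and it has integral one.
`Resampling.exp_le_measure_add_measure_compl` deduces the testing bound from this by Jensen's
inequality.

*Tradeoff.* If `R` bounds the regret in all these problems, then summing the testing bound over
epochs gives `Δ exp (-c Δ² n k - 1) S k ≤ Δ n k + R` for every `k ≠ b`, while `Δ ∑ n k ≤ R`.
Averaging over the arms and minimizing over each `n k`, by `y + 1 ≤ exp y`, yields the sum of
logarithms over `k ≠ b` (`sum_log_le_of_tradeoff`). The term of arm `b` is recovered because it is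
the smallest of the `K ≥ 2` terms.
-/

namespace AuxBandit

/-! ### Densities of product measures -/

section Density

theorem prod_withDensity_exp {α β : Type*} [MeasurableSpace α] [MeasurableSpace β]
    (μ : Measure α) (ν : Measure β) [SFinite μ] [SFinite ν] {f : α → ℝ} {g : β → ℝ}
    (hf : Measurable f) (hg : Measurable g) :
    (μ.withDensity fun x => ENNReal.ofReal (Real.exp (f x))).prod
        (ν.withDensity fun y => ENNReal.ofReal (Real.exp (g y))) =
      (μ.prod ν).withDensity fun z => ENNReal.ofReal (Real.exp (f z.1 + g z.2)) := by
  rw [prod_withDensity (by fun_prop) (by fun_prop)]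
  simp_rw [Real.exp_add, ENNReal.ofReal_mul (Real.exp_nonneg _)]

theorem pi_withDensity_exp {ι : Type*} [Fintype ι] {α : ι → Type*} [∀ i, MeasurableSpace (α i)]
    (μ ν : (i : ι) → Measure (α i)) [∀ i, IsProbabilityMeasure (μ i)]
    [∀ i, IsProbabilityMeasure (ν i)] {f : (i : ι) → α i → ℝ} (hf : ∀ i, Measurable (f i))
    (h : ∀ i, ν i = (μ i).withDensity fun x => ENNReal.ofReal (Real.exp (f i x))) :
    Measure.pi ν =
      (Measure.pi μ).withDensity fun x => ENNReal.ofReal (Real.exp (∑ i, f i (x i))) := by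
  classical
  refine Measure.pi_eq fun s hs => ?_
  rw [withDensity_apply _ (MeasurableSet.univ_pi hs),
    ← lintegral_indicator (MeasurableSet.univ_pi hs)]
  have key : ∀ x : (i : ι) → α i,
      (Set.univ.pi s).indicator
        (fun x => ENNReal.ofReal (Real.exp (∑ i, f i (x i)))) x =
      ∏ i, (s i).indicator (fun y => ENNReal.ofReal (Real.exp (f i y))) (x i) := by
    intro x
    by_cases hx : x ∈ Set.univ.pi s
    · rw [Set.indicator_of_mem hx, Real.exp_sum,
        ENNReal.ofReal_prod_of_nonneg fun i _ => Real.exp_nonneg _]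
      exact Finset.prod_congr rfl fun i _ => by rw [Set.indicator_of_mem (hx i trivial)]
    · rw [Set.indicator_of_notMem hx]
      simp only [Set.mem_pi, Set.mem_univ, true_imp_iff, not_forall] at hx
      obtain ⟨i, hi⟩ := hx
      exact (Finset.prod_eq_zero (Finset.mem_univ i) (Set.indicator_of_notMem hi _)).symm
  simp_rw [key]
  have hm : ∀ i, Measurable ((s i).indicator fun y => ENNReal.ofReal (Real.exp (f i y))) :=
    fun i => Measurable.indicator (by have := hf i; fun_prop) (hs i)
  have hind := iIndepFun_pi (μ := μ) (X := fun i =>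
    (s i).indicator fun y => ENNReal.ofReal (Real.exp (f i y))) fun i => (hm i).aemeasurable
  rw [lintegral_prod_eq_prod_lintegral_of_indepFun Finset.univ _ hind
    fun i => (hm i).comp (measurable_pi_apply i)]
  refine Finset.prod_congr rfl fun i _ => ?_
  rw [(measurePreserving_eval μ i).lintegral_comp (hm i), lintegral_indicator (hs i), h i,
    withDensity_apply _ (hs i)]

end Density

/-! ### Redrawing coordinates and discarding unobserved ones -/

section Resampling

/-- A measure-preserving transformation `f` of the `i`-th factor, driven by additional randomness of
law `ν`, lifts to the product. For `f = Prod.snd` and `ν = μ i` it redraws the `i`-th coordinate;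
the general form is what makes it work on nested products. -/
theorem measurePreserving_update {ι : Type*} [Fintype ι] [DecidableEq ι] {α : ι → Type*}
    [∀ i, MeasurableSpace (α i)] {β : Type*} [MeasurableSpace β]
    (μ : (i : ι) → Measure (α i)) [∀ i, IsProbabilityMeasure (μ i)]
    (ν : Measure β) [IsProbabilityMeasure ν] (i : ι) {f : α i × β → α i}
    (hf : MeasurePreserving f ((μ i).prod ν) (μ i)) :
    MeasurePreserving
      (fun q : ((j : ι) → α j) × β => Function.update q.1 i (f (q.1 i, q.2)))
      ((Measure.pi μ).prod ν) (Measure.pi μ) := by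
  have hfm := hf.measurable
  have hm : Measurable
      (fun q : ((j : ι) → α j) × β => Function.update q.1 i (f (q.1 i, q.2))) := by
    refine measurable_pi_iff.2 fun j => ?_
    by_cases hj : j = i
    · subst hj
      simp only [Function.update_self]
      fun_prop
    · simp only [Function.update_of_ne hj]
      fun_prop
  refine ⟨hm, (Measure.pi_eq fun s hs => ?_).symm⟩
  rw [Measure.map_apply hm (MeasurableSet.univ_pi hs),
    Measure.prod_apply_symm (hm (MeasurableSet.univ_pi hs))]
  have hsec : ∀ r : β, (fun x : (j : ι) → α j => (x, r)) ⁻¹'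
      ((fun q : ((j : ι) → α j) × β => Function.update q.1 i (f (q.1 i, q.2))) ⁻¹'
        Set.univ.pi s) =
      Set.univ.pi (Function.update s i ((fun a => (a, r)) ⁻¹' (f ⁻¹' s i))) := by
    intro r
    ext x
    simp only [Set.mem_preimage, Set.mem_pi, Set.mem_univ, true_imp_iff]
    refine forall_congr' fun j => ?_
    by_cases hj : j = i
    · subst hj; simp
    · simp [Function.update_of_ne hj]
  simp_rw [hsec, Measure.pi_pi]
  have hprod : ∀ r : β, ∏ j, μ j (Function.update s i ((fun a => (a, r)) ⁻¹' (f ⁻¹' s i)) j) =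
      μ i ((fun a => (a, r)) ⁻¹' (f ⁻¹' s i)) * ∏ j ∈ Finset.univ.erase i, μ j (s j) := by
    intro r
    rw [← Finset.mul_prod_erase _ _ (Finset.mem_univ i), Function.update_self]
    congr 1
    exact Finset.prod_congr rfl fun j hj => by
      rw [Function.update_of_ne (Finset.ne_of_mem_erase hj)]
  simp_rw [hprod]
  rw [lintegral_mul_const _ (measurable_measure_prodMk_right (hfm (hs i))),
    ← Measure.prod_apply_symm (hfm (hs i)), hf.measure_preimage (hs i).nullMeasurableSet,
    Finset.mul_prod_erase _ (fun j => μ j (s j)) (Finset.mem_univ i)]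

theorem measurePreserving_prod_right {α β γ : Type*} [MeasurableSpace α] [MeasurableSpace β]
    [MeasurableSpace γ] (μ : Measure α) (ν : Measure β) (ρ : Measure γ) [SFinite μ] [SFinite ν]
    [SFinite ρ] {f : β × γ → β} (hf : MeasurePreserving f (ν.prod ρ) ν) :
    MeasurePreserving (fun q : (α × β) × γ => (q.1.1, f (q.1.2, q.2)))
      ((μ.prod ν).prod ρ) (μ.prod ν) :=
  ((MeasurePreserving.id μ).prod hf).comp (measurePreserving_prodAssoc μ ν ρ)

theorem measurePreserving_prod_left {α β γ : Type*} [MeasurableSpace α] [MeasurableSpace β]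
    [MeasurableSpace γ] (μ : Measure α) (ν : Measure β) (ρ : Measure γ) [SFinite μ] [SFinite ν]
    [SFinite ρ] {f : α × γ → α} (hf : MeasurePreserving f (μ.prod ρ) μ) :
    MeasurePreserving (fun q : (α × β) × γ => (f (q.1.1, q.2), q.1.2))
      ((μ.prod ν).prod ρ) (μ.prod ν) :=
  (Measure.measurePreserving_swap.comp (measurePreserving_prod_right ν μ ρ hf)).comp
    ((Measure.measurePreserving_swap (μ := μ) (ν := ν)).prod (MeasurePreserving.id ρ))

/-- The maps `upd i` redraw the real-valued coordinates `ξ i` one at a time, and this leaves the law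
`P` unchanged: if `ω` has law `P` and `r` is independent of it with law `μ i`, then `upd i (ω, r)`,
in which the `i`-th coordinate is `r` and the other ones are those of `ω`, has law `P`. The
coordinates need not determine `ω`. -/
structure Resampling {Ω ι : Type*} [MeasurableSpace Ω] (P : Measure Ω) (μ : ι → Measure ℝ)
    (ξ : ι → Ω → ℝ) (upd : ι → Ω × ℝ → Ω) : Prop where
  /-- redrawing a coordinate from its law preserves `P` -/
  measurePreserving : ∀ i, MeasurePreserving (upd i) (P.prod (μ i)) P
  /-- the coordinates are random variables -/
  measurable : ∀ i, Measurable (ξ i)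
  /-- the redrawn coordinate takes the new value -/
  self : ∀ i ω r, ξ i (upd i (ω, r)) = r
  /-- the other coordinates keep their values -/
  of_ne : ∀ i j ω r, i ≠ j → ξ j (upd i (ω, r)) = ξ j ω

variable {Ω ι : Type*} [MeasurableSpace Ω] {P P' : Measure Ω}
  {μ : ι → Measure ℝ} [∀ i, IsProbabilityMeasure (μ i)] {ξ : ι → Ω → ℝ} {upd : ι → Ω × ℝ → Ω}
  {l : ι → ℝ → ℝ} {B : ι → Set Ω} {A : Set Ω}

open Classical in
/-- On an event `A`, the likelihood ratio `exp (∑ i, l i (ξ i))` may be replaced by the product of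
the factors of the observed coordinates only, where `B i` is the event that coordinate `i` is
observed, if redrawing an unobserved coordinate changes neither `A` nor any of the `B j`. -/
theorem Resampling.setLIntegral_observed [Fintype ι] (hR : Resampling P μ ξ upd)
    (hl : ∀ i, Measurable (l i))
    (hl1 : ∀ i, ∫⁻ r, ENNReal.ofReal (Real.exp (l i r)) ∂(μ i) = 1)
    (hBm : ∀ i, MeasurableSet (B i))
    (hB : ∀ i ω r, upd i (ω, r) ∈ B i ↔ ω ∈ B i)
    (hBj : ∀ i ω r, ω ∉ B i → ∀ j, (upd i (ω, r) ∈ B j ↔ ω ∈ B j))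
    (hAm : MeasurableSet A) (hA : ∀ i ω r, ω ∉ B i → (upd i (ω, r) ∈ A ↔ ω ∈ A)) :
    ∫⁻ ω in A, ENNReal.ofReal (Real.exp (∑ i, l i (ξ i ω))) ∂P =
      ∫⁻ ω in A, ENNReal.ofReal (Real.exp (∑ i, (B i).indicator (fun ω => l i (ξ i ω)) ω)) ∂P := by
  have hξ := hR.measurable
  -- `e S` is the log-likelihood ratio in which the unobserved coordinates of `S` are left out
  let e : Finset ι → ι → Ω → ℝ := fun S i ω =>
    if i ∈ S then (B i).indicator (fun ω => l i (ξ i ω)) ω else l i (ξ i ω)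
  have hem : ∀ S i, Measurable (e S i) := by
    intro S i
    have h1 : Measurable fun ω => l i (ξ i ω) := (hl i).comp (hξ i)
    by_cases hi : i ∈ S
    · simpa [e, hi] using h1.indicator (hBm i)
    · simpa [e, hi] using h1
  let Φ : Finset ι → Ω → ENNReal := fun S =>
    A.indicator fun ω => ENNReal.ofReal (Real.exp (∑ i, e S i ω))
  have hΦm : ∀ S, Measurable (Φ S) := fun S =>
    Measurable.indicator (by have := hem S; fun_prop) hAm
  have hint : ∀ S i, ∫⁻ ω, Φ S ω ∂P = ∫⁻ ω, ∫⁻ r, Φ S (upd i (ω, r)) ∂(μ i) ∂P := by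
    intro S i
    rw [← (hR.measurePreserving i).lintegral_comp (hΦm S),
      lintegral_prod (fun q => Φ S (upd i q))
        ((hΦm S).comp (hR.measurePreserving i).measurable).aemeasurable]
  have hstep : ∀ S, ∫⁻ ω, Φ S ω ∂P = ∫⁻ ω, Φ ∅ ω ∂P := by
    intro S
    induction S using Finset.induction_on with
    | empty => rfl
    | insert i S hi ih =>
      rw [← ih, hint _ i, hint S i]
      refine lintegral_congr fun ω => ?_
      have hoth : ∀ r, ∀ j ∈ Finset.univ.erase i,
          e (insert i S) j (upd i (ω, r)) = e S j (upd i (ω, r)) := by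
        intro r j hj
        have hji : j ≠ i := Finset.ne_of_mem_erase hj
        simp [e, hji]
      by_cases hω : ω ∈ B i
      · refine lintegral_congr fun r => ?_
        have : ∀ j, e (insert i S) j (upd i (ω, r)) = e S j (upd i (ω, r)) := by
          intro j
          by_cases hji : j = i
          · subst hji
            have := (hB j ω r).2 hω
            simp [e, hi, this]
          · exact hoth r j (by simp [hji])
        simp only [Φ, Set.indicator, this]
      · have hsame : ∀ r, ∀ j ∈ Finset.univ.erase i, e S j (upd i (ω, r)) = e S j ω := by
          intro r j hj
          have hji : i ≠ j := (Finset.ne_of_mem_erase hj).symm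
          have h1 := hBj i ω r hω j
          have h2 := hR.of_ne i j ω r hji
          simp only [e, Set.indicator, h1, h2]
        have h1 : ∀ r, ∑ j, e (insert i S) j (upd i (ω, r)) =
            ∑ j ∈ Finset.univ.erase i, e S j ω := by
          intro r
          have h0 : e (insert i S) i (upd i (ω, r)) = 0 := by
            have : upd i (ω, r) ∉ B i := fun h => hω ((hB i ω r).1 h)
            simp [e, this]
          rw [← Finset.add_sum_erase _ _ (Finset.mem_univ i), h0, zero_add]
          exact Finset.sum_congr rfl fun j hj => (hoth r j hj).trans (hsame r j hj)
        have h2 : ∀ r, ∑ j, e S j (upd i (ω, r)) =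
            l i r + ∑ j ∈ Finset.univ.erase i, e S j ω := by
          intro r
          have h0 : e S i (upd i (ω, r)) = l i r := by simp [e, hi, hR.self]
          rw [← Finset.add_sum_erase _ _ (Finset.mem_univ i), h0]
          exact congrArg _ (Finset.sum_congr rfl fun j hj => hsame r j hj)
        by_cases hωA : ω ∈ A
        · simp only [Φ, Set.indicator, hA i ω _ hω, hωA, if_true, h1, h2, Real.exp_add,
            ENNReal.ofReal_mul (Real.exp_nonneg _)]
          rw [lintegral_mul_const _ (by have := hl i; fun_prop), hl1 i]
          simp
        · simp only [Φ, Set.indicator, hA i ω _ hω, hωA, if_false]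
  have h := hstep Finset.univ
  simp only [Φ, lintegral_indicator hAm, e, Finset.mem_univ, if_true, Finset.notMem_empty,
    if_false] at h
  exact h.symm

/-- Wald's identity for one coordinate: its value is independent of its being observed. -/
theorem Resampling.integral_observed [IsProbabilityMeasure P] (hR : Resampling P μ ξ upd)
    (hBm : ∀ i, MeasurableSet (B i)) (hB : ∀ i ω r, upd i (ω, r) ∈ B i ↔ ω ∈ B i)
    (hli : ∀ i, Integrable (l i) (μ i)) (i : ι) :
    Integrable ((B i).indicator fun ω => l i (ξ i ω)) P ∧
      ∫ ω, (B i).indicator (fun ω => l i (ξ i ω)) ω ∂P = P.real (B i) * ∫ r, l i r ∂(μ i) := by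
  have hlaw : MeasurePreserving (ξ i) P (μ i) := by
    refine ⟨hR.measurable i, ?_⟩
    rw [← (hR.measurePreserving i).map_eq,
      Measure.map_map (hR.measurable i) (hR.measurePreserving i).measurable]
    have : ξ i ∘ upd i = Prod.snd := by ext ⟨ω, r⟩; exact hR.self i ω r
    rw [this]
    exact measurePreserving_snd.map_eq
  have hint : Integrable ((B i).indicator fun ω => l i (ξ i ω)) P :=
    (hlaw.integrable_comp_of_integrable (hli i)).indicator (hBm i)
  refine ⟨hint, ?_⟩
  have hmp := hR.measurePreserving i
  have h1 : ∫ ω, (B i).indicator (fun ω => l i (ξ i ω)) ω ∂P =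
      ∫ q, (B i).indicator (fun ω => l i (ξ i ω)) (upd i q) ∂(P.prod (μ i)) := by
    rw [← integral_map hmp.measurable.aemeasurable (by rw [hmp.map_eq]; exact hint.1), hmp.map_eq]
  have h2 : ∀ q : Ω × ℝ, (B i).indicator (fun ω => l i (ξ i ω)) (upd i q) =
      (B i).indicator (fun _ => (1 : ℝ)) q.1 * l i q.2 := by
    rintro ⟨ω, r⟩
    by_cases hω : ω ∈ B i
    · simp [hω, (hB i ω r).2 hω, hR.self]
    · have : upd i (ω, r) ∉ B i := fun h => hω ((hB i ω r).1 h)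
      simp [hω, this]
  rw [h1]
  simp_rw [h2]
  rw [integral_prod_mul, integral_indicator (hBm i)]
  simp

/-- A form of the Bretagnolle–Huber inequality in which only the observed coordinates count: the
exponent is minus the Kullback–Leibler information in the observed coordinates, minus one. -/
theorem Resampling.exp_le_measure_add_measure_compl [Fintype ι] [IsProbabilityMeasure P]
    (hR : Resampling P μ ξ upd)
    (hl : ∀ i, Measurable (l i))
    (hl1 : ∀ i, ∫⁻ r, ENNReal.ofReal (Real.exp (l i r)) ∂(μ i) = 1)
    (hli : ∀ i, Integrable (l i) (μ i))
    (hBm : ∀ i, MeasurableSet (B i))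
    (hB : ∀ i ω r, upd i (ω, r) ∈ B i ↔ ω ∈ B i)
    (hBj : ∀ i ω r, ω ∉ B i → ∀ j, (upd i (ω, r) ∈ B j ↔ ω ∈ B j))
    (hAm : MeasurableSet A) (hA : ∀ i ω r, ω ∉ B i → (upd i (ω, r) ∈ A ↔ ω ∈ A))
    (hP' : P' = P.withDensity fun ω => ENNReal.ofReal (Real.exp (∑ i, l i (ξ i ω)))) :
    Real.exp (∑ i, P.real (B i) * ∫ r, l i r ∂(μ i) - 1) ≤ P.real A + P'.real Aᶜ := by
  have hint := hR.integral_observed hBm hB hli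
  set Λ : Ω → ℝ := fun ω => ∑ i, (B i).indicator (fun ω => l i (ξ i ω)) ω with hΛ
  have hΛint : Integrable Λ P := integrable_finsetSum _ fun i _ => (hint i).1
  have hΛval : ∫ ω, Λ ω ∂P = ∑ i, P.real (B i) * ∫ r, l i r ∂(μ i) := by
    rw [hΛ, integral_finsetSum _ fun i _ => (hint i).1]
    exact Finset.sum_congr rfl fun i _ => (hint i).2
  have hΛm : Measurable Λ := Finset.measurable_sum _ fun i _ =>
    ((hl i).comp (hR.measurable i)).indicator (hBm i)
  have hAc : ∫⁻ ω in Aᶜ, ENNReal.ofReal (Real.exp (Λ ω)) ∂P = P' Aᶜ := by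
    rw [hP', withDensity_apply _ hAm.compl]
    exact (hR.setLIntegral_observed hl hl1 hBm hB hBj hAm.compl fun i ω r h =>
      not_congr (hA i ω r h)).symm
  have hone : ∫⁻ ω, ENNReal.ofReal (Real.exp (Λ ω)) ∂P = 1 := by
    -- the full ratio has the same mean as the ratio of the observed coordinates, and also as the
    -- ratio of no coordinates, which is `1`
    have h1 := hR.setLIntegral_observed hl hl1 hBm hB hBj MeasurableSet.univ
      fun i ω r _ => by simp
    have h2 := hR.setLIntegral_observed (B := fun _ => ∅) hl hl1 (fun _ => MeasurableSet.empty)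
      (fun i ω r => by simp) (fun i ω r _ j => by simp) MeasurableSet.univ
      fun i ω r _ => by simp
    simp only [Measure.restrict_univ] at h1 h2
    rw [← h1, h2]
    simp
  have hexpint : Integrable (fun ω => Real.exp (Λ ω)) P := by
    refine ⟨(by fun_prop : Measurable fun ω => Real.exp (Λ ω)).aestronglyMeasurable, ?_⟩
    rw [hasFiniteIntegral_iff_ofReal (Filter.Eventually.of_forall fun _ => Real.exp_nonneg _), hone]
    exact ENNReal.one_lt_top
  have hexpval : ∫ ω, Real.exp (Λ ω) ∂P = 1 := by
    rw [integral_eq_lintegral_of_nonneg_ae (Filter.Eventually.of_forall fun _ => Real.exp_nonneg _)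
      hexpint.1, hone, ENNReal.toReal_one]
  have hcval : ∫ ω in Aᶜ, Real.exp (Λ ω) ∂P = P'.real Aᶜ := by
    rw [integral_eq_lintegral_of_nonneg_ae (Filter.Eventually.of_forall fun _ => Real.exp_nonneg _)
      hexpint.1.restrict, hAc, measureReal_def]
  set m : ℝ := ∑ i, P.real (B i) * ∫ r, l i r ∂(μ i) - 1 with hm
  -- `min 1 (exp Λ)` is at least its tangent `exp m * (1 + min Λ 0 - m)`, in which
  -- `min Λ 0 ≥ Λ - exp Λ`; the mean of `Λ - exp Λ` is `m`
  have hpt : ∀ ω, Real.exp m * (1 + (Λ ω - Real.exp (Λ ω)) - m) ≤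
      A.indicator (fun _ => (1 : ℝ)) ω + Aᶜ.indicator (fun ω => Real.exp (Λ ω)) ω := by
    intro ω
    have h1 : Λ ω - Real.exp (Λ ω) ≤ min (Λ ω) 0 :=
      le_min (by linarith [Real.exp_pos (Λ ω)]) (by linarith [Real.add_one_le_exp (Λ ω)])
    have h2 : Real.exp m * (1 + (Λ ω - Real.exp (Λ ω)) - m) ≤ Real.exp (min (Λ ω) 0) := by
      calc _ ≤ Real.exp m * (min (Λ ω) 0 - m + 1) :=
            mul_le_mul_of_nonneg_left (by linarith) (Real.exp_nonneg _)
        _ ≤ Real.exp m * Real.exp (min (Λ ω) 0 - m) :=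
            mul_le_mul_of_nonneg_left (Real.add_one_le_exp _) (Real.exp_nonneg _)
        _ = _ := by rw [← Real.exp_add]; congr 1; ring
    refine h2.trans ?_
    by_cases hω : ω ∈ A
    · simp [hω]
    · simp [hω]
  have hfin := integral_mono (μ := P)
    (f := fun ω => Real.exp m * (1 + (Λ ω - Real.exp (Λ ω)) - m))
    (g := fun ω => A.indicator (fun _ => (1 : ℝ)) ω + Aᶜ.indicator (fun ω => Real.exp (Λ ω)) ω)
    (by fun_prop)
    (((integrable_const _).indicator hAm).add (hexpint.indicator hAm.compl)) hpt
  rw [integral_const_mul, integral_sub (by fun_prop) (by fun_prop),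
    integral_add (by fun_prop) (by fun_prop), integral_sub hΛint hexpint, hΛval, hexpval,
    integral_add ((integrable_const _).indicator hAm) (hexpint.indicator hAm.compl),
    integral_indicator hAm, integral_indicator hAm.compl, hcval] at hfin
  simp only [integral_const, probReal_univ, smul_eq_mul, one_mul, mul_one,
    measureReal_restrict_apply, MeasurableSet.univ, Set.univ_inter] at hfin
  calc Real.exp m = Real.exp m * (1 + (∑ i, P.real (B i) * ∫ r, l i r ∂(μ i) - 1) - m) := by
        rw [← hm]; ring
    _ ≤ _ := hfin

end Resampling

/-! ### Likelihood ratios of Gaussian laws -/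

section Gaussian

/-- The logarithm of the density of `gaussianReal b v` with respect to `gaussianReal a v`. -/
noncomputable def gaussianLogRatio (v : ℝ≥0) (a b x : ℝ) : ℝ :=
  (b - a) / v * x - (b ^ 2 - a ^ 2) / (2 * v)

theorem gaussianLogRatio_self (v : ℝ≥0) (a x : ℝ) : gaussianLogRatio v a a x = 0 := by
  simp [gaussianLogRatio]

theorem measurable_gaussianLogRatio (v : ℝ≥0) (a b : ℝ) : Measurable (gaussianLogRatio v a b) := by
  unfold gaussianLogRatio
  fun_prop

theorem gaussianReal_eq_withDensity {v : ℝ≥0} (hv : v ≠ 0) (a b : ℝ) :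
    gaussianReal b v = (gaussianReal a v).withDensity
      fun x => ENNReal.ofReal (Real.exp (gaussianLogRatio v a b x)) := by
  have hv' : (v : ℝ) ≠ 0 := by exact_mod_cast hv
  have := measurable_gaussianLogRatio v a b
  rw [gaussianReal_of_var_ne_zero a hv, gaussianReal_of_var_ne_zero b hv,
    ← withDensity_mul _ (measurable_gaussianPDF a v) (by fun_prop)]
  congr 1
  ext x
  rw [Pi.mul_apply, gaussianPDF, gaussianPDF, ← ENNReal.ofReal_mul (gaussianPDFReal_nonneg _ _ _),
    gaussianPDFReal, gaussianPDFReal, mul_assoc (√_)⁻¹, ← Real.exp_add, gaussianLogRatio]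
  congr 3
  field_simp
  ring

theorem lintegral_exp_gaussianLogRatio {v : ℝ≥0} (hv : v ≠ 0) (a b : ℝ) :
    ∫⁻ x, ENNReal.ofReal (Real.exp (gaussianLogRatio v a b x)) ∂(gaussianReal a v) = 1 := by
  rw [← setLIntegral_univ, ← withDensity_apply _ MeasurableSet.univ,
    ← gaussianReal_eq_withDensity hv, measure_univ]

theorem integrable_id_gaussianReal (a : ℝ) (v : ℝ≥0) :
    Integrable (fun x => x) (gaussianReal a v) :=
  memLp_one_iff_integrable.1 (memLp_id_gaussianReal 1)

theorem integrable_gaussianLogRatio (v : ℝ≥0) (a b : ℝ) :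
    Integrable (gaussianLogRatio v a b) (gaussianReal a v) :=
  ((integrable_id_gaussianReal a v).const_mul _).sub (integrable_const _)

theorem integral_gaussianLogRatio (v : ℝ≥0) (a b : ℝ) :
    ∫ x, gaussianLogRatio v a b x ∂(gaussianReal a v) = -((b - a) ^ 2 / (2 * v)) := by
  unfold gaussianLogRatio
  rw [integral_sub ((integrable_id_gaussianReal a v).const_mul _) (integrable_const _),
    integral_const_mul, integral_id_gaussianReal]
  simp
  ring

end Gaussian

variable {K T : ℕ}

/-! ### Dependence of the actions on the observations -/

section Actions

/-- The action at epoch `t` depends on the reward table only through the entries that the policy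
collected before `t`, and on the auxiliary feedback only up to `t`. -/
theorem action_congr (π : Policy K T) (H : Fin K → Fin T → ℕ) (u : π.U)
    {x x' z z' : Fin T → Fin K → ℝ} (t : Fin T)
    (hx : ∀ s < t, x s (action π H u x z s) = x' s (action π H u x z s))
    (hz : ∀ s ≤ t, z s = z' s) : action π H u x z t = action π H u x' z' t := by
  induction t using WellFoundedLT.induction with
  | ind t ih =>
    have h1 : (fun s : Set.Iio t => x s.1 (action π H u x z s.1)) =
        fun s : Set.Iio t => x' s.1 (action π H u x' z' s.1) := by
      funext s
      have hs : s.1 < t := s.2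
      rw [← ih s.1 hs (fun r hr => hx r (hr.trans hs)) fun r hr => hz r (hr.trans hs.le)]
      exact hx s.1 hs
    have h2 : (fun s : Set.Iic t => z s.1) = fun s : Set.Iic t => z' s.1 :=
      funext fun s => hz s.1 s.2
    rw [action, action, h1, h2]

theorem measurable_action (π : Policy K T) (H : Fin K → Fin T → ℕ) (t : Fin T) :
    Measurable fun q : π.U × (Fin T → Fin K → ℝ) × (Fin T → Fin K → ℝ) =>
      action π H q.1 q.2.1 q.2.2 t := by
  induction t using WellFoundedLT.induction with
  | ind t ih =>
    have hx : ∀ s : Set.Iio t,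
        Measurable fun q : π.U × (Fin T → Fin K → ℝ) × (Fin T → Fin K → ℝ) =>
          q.2.1 s.1 (action π H q.1 q.2.1 q.2.2 s.1) := by
      intro s
      have hev : Measurable fun w : (Fin T → Fin K → ℝ) × Fin K => w.1 s.1 w.2 :=
        measurable_from_prod_countable_left fun k =>
          (measurable_pi_apply k).comp (measurable_pi_apply s.1)
      exact hev.comp ((by fun_prop : Measurable fun q : π.U × (Fin T → Fin K → ℝ) ×
        (Fin T → Fin K → ℝ) => q.2.1).prodMk (ih s.1 s.2))
    have hrec : (fun q : π.U × (Fin T → Fin K → ℝ) × (Fin T → Fin K → ℝ) =>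
        action π H q.1 q.2.1 q.2.2 t) = fun q => π.rule t
          ((fun s => q.2.1 s.1 (action π H q.1 q.2.1 q.2.2 s.1), fun s => q.2.2 s.1,
            fun s k => H k s.1), q.1) := by
      funext q
      rw [action]
    rw [hrec]
    refine (π.measurable_rule t).comp (Measurable.prodMk (Measurable.prodMk ?_
      (Measurable.prodMk ?_ measurable_const)) (by fun_prop))
    · exact measurable_pi_iff.2 hx
    · exact measurable_pi_iff.2 fun s => by fun_prop

/-- The arm selected at epoch `t`, as a random variable on the sample space in which the entries of
the auxiliary table are the mapped observations `φ k (Y k t m)` themselves. -/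
noncomputable def choice (π : Policy K T) (H : Fin K → Fin T → ℕ) (t : Fin T)
    (ω : π.U × (Fin T → Fin K → ℝ) × AuxTable H) : Fin K :=
  action π H ω.1 ω.2.1 (auxAverage (fun _ => id) H ω.2.2) t

theorem measurable_auxAverage (H : Fin K → Fin T → ℕ) {φ : Fin K → ℝ → ℝ}
    (hφ : ∀ k, Measurable (φ k)) : Measurable (auxAverage (T := T) φ H) := by
  refine measurable_pi_iff.2 fun t => measurable_pi_iff.2 fun k => ?_
  have := hφ k
  unfold auxAverage
  fun_prop

theorem measurable_choice (π : Policy K T) (H : Fin K → Fin T → ℕ) (t : Fin T) :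
    Measurable (choice π H t) := by
  have h := measurable_auxAverage (T := T) H (φ := fun _ => id) fun _ => measurable_id
  exact (measurable_action π H t).comp (measurable_fst.prodMk
    ((measurable_fst.comp measurable_snd).prodMk (h.comp (measurable_snd.comp measurable_snd))))

theorem measurableSet_choice_eq (π : Policy K T) (H : Fin K → Fin T → ℕ) (t : Fin T)
    (k : Fin K) : MeasurableSet {ω | choice π H t ω = k} :=
  measurable_choice π H t (measurableSet_singleton k)

end Actions

/-! ### The Gaussian model -/

section Model

instance (π : Policy K T) (H : Fin K → Fin T → ℕ)
    (p : (Fin K → ProbabilityMeasure ℝ) × (Fin K → ProbabilityMeasure ℝ)) :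
    IsProbabilityMeasure (sampleLaw π H p) := by
  unfold sampleLaw
  infer_instance

/-- The Gaussian laws with variance `v` and means `θ`. -/
noncomputable def gaussianProfile (θ : Fin K → ℝ) (v : ℝ≥0) (k : Fin K) : ProbabilityMeasure ℝ :=
  ⟨gaussianReal (θ k) v, inferInstance⟩

theorem mean_gaussianProfile (θ : Fin K → ℝ) (v : ℝ≥0) (k : Fin K) :
    mean (gaussianProfile θ v k) = θ k :=
  integral_id_gaussianReal

/-- The law of the private randomization, of the rewards, which are Gaussian with means `θ` and
variance `v`, and of the mapped auxiliary observations, Gaussian with means `θ` and variance `w`. -/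
noncomputable def gaussianModel (π : Policy K T) (H : Fin K → Fin T → ℕ) (v w : ℝ≥0)
    (θ : Fin K → ℝ) : Measure (π.U × (Fin T → Fin K → ℝ) × AuxTable H) :=
  sampleLaw π H (gaussianProfile θ v, gaussianProfile θ w)

instance (π : Policy K T) (H : Fin K → Fin T → ℕ) (v w : ℝ≥0) (θ : Fin K → ℝ) :
    IsProbabilityMeasure (gaussianModel π H v w θ) := by
  unfold gaussianModel
  infer_instance

/-- The auxiliary laws enter the regret only through their images under `φ`. This matters because
two auxiliary laws with Gaussian images need not have a density with respect to each other. -/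
theorem regret_eq_sum (φ : Fin K → ℝ → ℝ) (hφ : ∀ k, Measurable (φ k)) (H : Fin K → Fin T → ℕ)
    (π : Policy K T) (v w : ℝ≥0) (θ : Fin K → ℝ) (ρ : Fin K → ProbabilityMeasure ℝ)
    (hρ : ∀ k, (ρ k : Measure ℝ).map (φ k) = gaussianReal (θ k) w) :
    regret φ H π (gaussianProfile θ v, ρ) =
      ∑ t, ∑ k, gap (gaussianProfile θ v) k *
        (gaussianModel π H v w θ).real {ω | choice π H t ω = k} := by
  set P := gaussianModel π H v w θ with hP
  let Ψ : π.U × (Fin T → Fin K → ℝ) × AuxTable H → π.U × (Fin T → Fin K → ℝ) × AuxTable H :=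
    fun ω => (ω.1, ω.2.1, fun t k m => φ k (ω.2.2 t k m))
  have haux : MeasurePreserving (fun (y : AuxTable H) t k m => φ k (y t k m))
      (Measure.pi fun t => Measure.pi fun k => Measure.pi fun _ : Fin (H k t) => (ρ k : Measure ℝ))
      (Measure.pi fun t => Measure.pi fun k => Measure.pi fun _ : Fin (H k t) =>
        gaussianReal (θ k) w) :=
    measurePreserving_pi _ _ fun t => measurePreserving_pi _ _ fun k =>
      measurePreserving_pi _ _ fun _ => ⟨hφ k, hρ k⟩
  have hΨ : MeasurePreserving Ψ (sampleLaw π H (gaussianProfile θ v, ρ)) P :=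
    (MeasurePreserving.id _).prod ((MeasurePreserving.id _).prod haux)
  have hact : ∀ t ω, action π H ω.1 ω.2.1 (auxAverage φ H ω.2.2) t = choice π H t (Ψ ω) :=
    fun t ω => rfl
  have hset := measurableSet_choice_eq π H
  have hpt : ∀ ω, ∑ t, (bestMean (gaussianProfile θ v) - mean (gaussianProfile θ v
      (choice π H t ω))) = ∑ t, ∑ k, gap (gaussianProfile θ v) k *
        {ω | choice π H t ω = k}.indicator (fun _ => (1 : ℝ)) ω := by
    intro ω
    refine Finset.sum_congr rfl fun t _ => ?_
    rw [Finset.sum_eq_single (choice π H t ω)]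
    · simp [gap]
    · intro k _ hk
      simp [Ne.symm hk]
    · simp
  have hint : ∀ t k, Integrable (fun ω => gap (gaussianProfile θ v) k *
        {ω | choice π H t ω = k}.indicator (fun _ => (1 : ℝ)) ω) P :=
    fun t k => ((integrable_const _).indicator (hset t k)).const_mul _
  have hmeas : Measurable fun ω => ∑ t, ∑ k, gap (gaussianProfile θ v) k *
        {ω | choice π H t ω = k}.indicator (fun _ => (1 : ℝ)) ω :=
    Finset.measurable_sum _ fun t _ => Finset.measurable_sum _ fun k _ =>
      (measurable_const.indicator (hset t k)).const_mul _
  unfold regret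
  simp_rw [hact, hpt]
  rw [← integral_map (f := fun ω => ∑ t, ∑ k, gap (gaussianProfile θ v) k *
        {ω | choice π H t ω = k}.indicator (fun _ => (1 : ℝ)) ω) hΨ.measurable.aemeasurable
      hmeas.aestronglyMeasurable, hΨ.map_eq,
    integral_finsetSum _ fun t _ => integrable_finsetSum _ fun k _ => hint t k]
  refine Finset.sum_congr rfl fun t _ => ?_
  rw [integral_finsetSum _ fun k _ => hint t k]
  refine Finset.sum_congr rfl fun k _ => ?_
  rw [integral_const_mul, integral_indicator (hset t k)]
  simp

theorem gaussianModel_eq_withDensity (π : Policy K T) (H : Fin K → Fin T → ℕ) {v w : ℝ≥0}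
    (hv : v ≠ 0) (hw : w ≠ 0) (θ θ' : Fin K → ℝ) :
    gaussianModel π H v w θ' = (gaussianModel π H v w θ).withDensity fun ω =>
      ENNReal.ofReal (Real.exp
        ((∑ s, ∑ k, gaussianLogRatio v (θ k) (θ' k) (ω.2.1 s k)) +
          ∑ s, ∑ k, ∑ m, gaussianLogRatio w (θ k) (θ' k) (ω.2.2 s k m))) := by
  have hmv := fun k => measurable_gaussianLogRatio v (θ k) (θ' k)
  have hmw := fun k => measurable_gaussianLogRatio w (θ k) (θ' k)
  have hX : (Measure.pi fun _ : Fin T => Measure.pi fun k => gaussianReal (θ' k) v) =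
      (Measure.pi fun _ : Fin T => Measure.pi fun k => gaussianReal (θ k) v).withDensity fun x =>
        ENNReal.ofReal (Real.exp (∑ s, ∑ k, gaussianLogRatio v (θ k) (θ' k) (x s k))) :=
    pi_withDensity_exp _ _
      (f := fun _ (x : Fin K → ℝ) => ∑ k, gaussianLogRatio v (θ k) (θ' k) (x k))
      (fun _ => by fun_prop) fun _ =>
      pi_withDensity_exp _ _ (fun k => hmv k) fun k => gaussianReal_eq_withDensity hv _ _
  have hY : (Measure.pi fun t => Measure.pi fun k => Measure.pi fun _ : Fin (H k t) =>
        gaussianReal (θ' k) w) =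
      (Measure.pi fun t => Measure.pi fun k => Measure.pi fun _ : Fin (H k t) =>
        gaussianReal (θ k) w).withDensity fun y : AuxTable H =>
        ENNReal.ofReal (Real.exp
          (∑ s, ∑ k, ∑ m, gaussianLogRatio w (θ k) (θ' k) (y s k m))) :=
    pi_withDensity_exp _ _
      (f := fun t (y : (k : Fin K) → Fin (H k t) → ℝ) =>
        ∑ k, ∑ m, gaussianLogRatio w (θ k) (θ' k) (y k m))
      (fun _ => by fun_prop) fun t =>
      pi_withDensity_exp _ _
        (f := fun k (y : Fin (H k t) → ℝ) => ∑ m, gaussianLogRatio w (θ k) (θ' k) (y m))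
        (fun _ => by fun_prop) fun k =>
        pi_withDensity_exp _ _ (fun _ => hmw k) fun _ => gaussianReal_eq_withDensity hw _ _
  have hU : π.law = π.law.withDensity fun _ => ENNReal.ofReal (Real.exp 0) := by
    simp
  change π.law.prod ((Measure.pi fun _ : Fin T => Measure.pi fun k => gaussianReal (θ' k) v).prod
    (Measure.pi fun t => Measure.pi fun k => Measure.pi fun _ : Fin (H k t) =>
        gaussianReal (θ' k) w)) = (π.law.prod
    ((Measure.pi fun _ : Fin T => Measure.pi fun k => gaussianReal (θ k) v).prod
    (Measure.pi fun t => Measure.pi fun k => Measure.pi fun _ : Fin (H k t) =>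
        gaussianReal (θ k) w))).withDensity _
  rw [hX, hY, prod_withDensity_exp _ _
      (f := fun x : Fin T → Fin K → ℝ => ∑ s, ∑ k, gaussianLogRatio v (θ k) (θ' k) (x s k))
      (g := fun y : AuxTable H => ∑ s, ∑ k, ∑ m, gaussianLogRatio w (θ k) (θ' k) (y s k m))
      (by fun_prop) (by fun_prop),
    prod_withDensity_right (by fun_prop)]

end Model

/-! ### Testing the mean of one arm -/

section Testing

variable (π : Policy K T) (H : Fin K → Fin T → ℕ) (k : Fin K)

/-- The coordinates of the sample space that concern arm `k`: its reward at each epoch, whether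
collected or not, and its auxiliary observations. -/
abbrev ObsIndex (H : Fin K → Fin T → ℕ) (k : Fin K) : Type :=
  Fin T ⊕ (Σ t : Fin T, Fin (H k t))

/-- The value of a coordinate that concerns arm `k`. -/
def obsValue : ObsIndex H k → π.U × (Fin T → Fin K → ℝ) × AuxTable H → ℝ
  | .inl s, ω => ω.2.1 s k
  | .inr i, ω => ω.2.2 i.1 k i.2

/-- The sample point in which a coordinate that concerns arm `k` is replaced by a given number. -/
def obsUpdate : ObsIndex H k → (π.U × (Fin T → Fin K → ℝ) × AuxTable H) × ℝ →
    π.U × (Fin T → Fin K → ℝ) × AuxTable H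
  | .inl s, q => (q.1.1, Function.update q.1.2.1 s (Function.update (q.1.2.1 s) k q.2), q.1.2.2)
  | .inr i, q => (q.1.1, q.1.2.1, Function.update q.1.2.2 i.1
      (Function.update (q.1.2.2 i.1) k (Function.update (q.1.2.2 i.1 k) i.2 q.2)))

/-- The laws of the coordinates that concern an arm with mean `a`. -/
noncomputable def obsLaw (v w : ℝ≥0) (a : ℝ) : ObsIndex H k → Measure ℝ
  | .inl _ => gaussianReal a v
  | .inr _ => gaussianReal a w

instance (v w : ℝ≥0) (a : ℝ) (i : ObsIndex H k) : IsProbabilityMeasure (obsLaw H k v w a i) := by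
  cases i <;> (unfold obsLaw; infer_instance)

/-- The event that a coordinate that concerns arm `k` is available to the decision at epoch `t`:
rewards are if they were collected before `t`, auxiliary observations if they arrived up to `t`. -/
def observed (t : Fin T) : ObsIndex H k → Set (π.U × (Fin T → Fin K → ℝ) × AuxTable H)
  | .inl s => {ω | s < t ∧ choice π H s ω = k}
  | .inr i => {_ω | i.1 ≤ t}

theorem resampling_obs (v w : ℝ≥0) (θ : Fin K → ℝ) :
    Resampling (gaussianModel π H v w θ) (obsLaw H k v w (θ k)) (obsValue π H k)
      (obsUpdate π H k) where
  measurePreserving := by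
    rintro (s | i)
    · have h1 := measurePreserving_update (fun k => gaussianReal (θ k) v) (gaussianReal (θ k) v) k
        measurePreserving_snd
      have h2 := measurePreserving_update
        (fun _ : Fin T => Measure.pi fun k => gaussianReal (θ k) v) _ s h1
      exact measurePreserving_prod_right _ _ _ (measurePreserving_prod_left _ _ _ h2)
    · have h1 := measurePreserving_update (fun _ : Fin (H k i.1) => gaussianReal (θ k) w)
        (gaussianReal (θ k) w) i.2 measurePreserving_snd
      have h2 := measurePreserving_update
        (fun k => Measure.pi fun _ : Fin (H k i.1) => gaussianReal (θ k) w) _ k h1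
      have h3 := measurePreserving_update
        (fun t => Measure.pi fun k => Measure.pi fun _ : Fin (H k t) => gaussianReal (θ k) w)
        _ i.1 h2
      exact measurePreserving_prod_right _ _ _ (measurePreserving_prod_right _ _ _ h3)
  measurable := by
    rintro (s | i) <;> (unfold obsValue; fun_prop)
  self := by
    rintro (s | i) ω r <;> simp [obsValue, obsUpdate]
  of_ne := by
    rintro (s | ⟨s, m⟩) (s' | ⟨s', m'⟩) ω r hne
    · have : s' ≠ s := fun h => hne (by rw [h])
      simp [obsValue, obsUpdate, this]
    · rfl
    · rfl
    · by_cases hs : s' = s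
      · subst hs
        have : m' ≠ m := fun h => hne (by rw [h])
        simp [obsValue, obsUpdate, this]
      · simp [obsValue, obsUpdate, hs]

theorem choice_obsUpdate_inl {s s' : Fin T} {ω : π.U × (Fin T → Fin K → ℝ) × AuxTable H} (r : ℝ)
    (h : s < s' → choice π H s ω ≠ k) :
    choice π H s' (obsUpdate π H k (.inl s) (ω, r)) = choice π H s' ω := by
  refine (action_congr π H _ s' (fun j hj => ?_) fun _ _ => rfl).symm
  change _ = Function.update ω.2.1 s (Function.update (ω.2.1 s) k r) j _
  by_cases hjs : j = s
  · subst hjs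
    rw [Function.update_self]
    exact (Function.update_of_ne (h hj) _ _).symm
  · rw [Function.update_of_ne hjs]

theorem choice_obsUpdate_inr {i : Σ t : Fin T, Fin (H k t)} {s : Fin T}
    {ω : π.U × (Fin T → Fin K → ℝ) × AuxTable H} (r : ℝ) (h : s < i.1) :
    choice π H s (obsUpdate π H k (.inr i) (ω, r)) = choice π H s ω := by
  refine (action_congr π H _ s (fun _ _ => rfl) fun j hj => ?_).symm
  have hji : j ≠ i.1 := (hj.trans_lt h).ne
  funext k'
  simp [auxAverage, obsUpdate, hji]

/-- Redrawing a coordinate that is unobserved at epoch `t` does not affect the choices up to `t`. -/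
theorem choice_obsUpdate_of_notMem {t s : Fin T} (hs : s ≤ t) {i : ObsIndex H k}
    {ω : π.U × (Fin T → Fin K → ℝ) × AuxTable H} (r : ℝ) (h : ω ∉ observed π H k t i) :
    choice π H s (obsUpdate π H k i (ω, r)) = choice π H s ω := by
  rcases i with j | i
  · exact choice_obsUpdate_inl π H k r fun hj hk => h ⟨hj.trans_le hs, hk⟩
  · exact choice_obsUpdate_inr π H k r (hs.trans_lt (not_le.1 h))

theorem obsUpdate_mem_observed (t : Fin T) (i : ObsIndex H k)
    (ω : π.U × (Fin T → Fin K → ℝ) × AuxTable H) (r : ℝ) :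
    obsUpdate π H k i (ω, r) ∈ observed π H k t i ↔ ω ∈ observed π H k t i := by
  rcases i with j | i
  · simp only [observed, Set.mem_ofPred_eq,
      choice_obsUpdate_inl π H k r fun h : j < j => (lt_irrefl j h).elim]
  · rfl

theorem obsUpdate_mem_observed_of_notMem (t : Fin T) (i : ObsIndex H k)
    (ω : π.U × (Fin T → Fin K → ℝ) × AuxTable H) (r : ℝ) (h : ω ∉ observed π H k t i)
    (j : ObsIndex H k) :
    obsUpdate π H k i (ω, r) ∈ observed π H k t j ↔ ω ∈ observed π H k t j := by
  rcases j with s | j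
  · refine and_congr_right fun hs => ?_
    rw [choice_obsUpdate_of_notMem π H k hs.le r h]
  · rfl

theorem measurableSet_observed (t : Fin T) (i : ObsIndex H k) :
    MeasurableSet (observed π H k t i) := by
  rcases i with s | i
  · exact (MeasurableSet.const _).inter (measurableSet_choice_eq π H s k)
  · exact MeasurableSet.const _

/-- If two Gaussian problems differ only in the mean of arm `k`, then the decision at epoch `t`
cannot tell them apart better than the observations on arm `k` up to `t` allow. -/
theorem exp_le_choice_add_choice_ne {v w : ℝ≥0} (hv : v ≠ 0) (hw : w ≠ 0) {θ θ' : Fin K → ℝ}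
    (hθ : ∀ j, j ≠ k → θ' j = θ j) (t : Fin T) :
    Real.exp (-((θ' k - θ k) ^ 2 / (2 * v) *
        ∑ s, (gaussianModel π H v w θ).real {ω | choice π H s ω = k}) -
        (θ' k - θ k) ^ 2 / (2 * w) * (∑ s ∈ Finset.Iic t, (H k s : ℝ)) - 1) ≤
      (gaussianModel π H v w θ).real {ω | choice π H t ω = k} +
        (gaussianModel π H v w θ').real {ω | choice π H t ω ≠ k} := by
  set P := gaussianModel π H v w θ with hP
  let l : ObsIndex H k → ℝ → ℝ := Sum.elim (fun _ => gaussianLogRatio v (θ k) (θ' k))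
    fun _ => gaussianLogRatio w (θ k) (θ' k)
  have hdens : gaussianModel π H v w θ' =
      P.withDensity fun ω => ENNReal.ofReal (Real.exp (∑ i, l i (obsValue π H k i ω))) := by
    rw [gaussianModel_eq_withDensity π H hv hw θ θ']
    congr 1
    funext ω
    congr 2
    rw [Fintype.sum_sum_type, Fintype.sum_sigma]
    congr 1
    · refine Finset.sum_congr rfl fun s _ => ?_
      rw [Finset.sum_eq_single k]
      · rfl
      · intro j _ hj
        rw [hθ j hj, gaussianLogRatio_self]
      · simp
    · refine Finset.sum_congr rfl fun s _ => ?_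
      rw [Finset.sum_eq_single k]
      · rfl
      · intro j _ hj
        simp [hθ j hj, gaussianLogRatio_self]
      · simp
  have key := (resampling_obs π H k v w θ).exp_le_measure_add_measure_compl (l := l)
    (B := observed π H k t) (A := {ω | choice π H t ω = k}) (P' := gaussianModel π H v w θ')
    (by rintro (s | i) <;> exact measurable_gaussianLogRatio _ _ _)
    (by rintro (s | i); exacts [lintegral_exp_gaussianLogRatio hv _ _,
          lintegral_exp_gaussianLogRatio hw _ _])
    (by rintro (s | i) <;> exact integrable_gaussianLogRatio _ _ _)
    (measurableSet_observed π H k t) (obsUpdate_mem_observed π H k t)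
    (obsUpdate_mem_observed_of_notMem π H k t) (measurableSet_choice_eq π H t k)
    (fun i ω r h => by
      simp only [Set.mem_ofPred_eq, choice_obsUpdate_of_notMem π H k le_rfl r h]) hdens
  refine (Real.exp_le_exp.2 ?_).trans key
  rw [Fintype.sum_sum_type, Fintype.sum_sigma]
  have hrew : ∑ s : Fin T, P.real (observed π H k t (.inl s)) *
      ∫ r, l (.inl s) r ∂(obsLaw H k v w (θ k) (.inl s)) ≥
      -((θ' k - θ k) ^ 2 / (2 * v) * ∑ s, P.real {ω | choice π H s ω = k}) := by
    rw [Finset.mul_sum, ← Finset.sum_neg_distrib]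
    refine Finset.sum_le_sum fun s _ => ?_
    have h1 : ∫ r, l (.inl s) r ∂(obsLaw H k v w (θ k) (.inl s)) =
      -((θ' k - θ k) ^ 2 / (2 * v)) := integral_gaussianLogRatio v (θ k) (θ' k)
    have h2 : P.real (observed π H k t (.inl s)) ≤ P.real {ω | choice π H s ω = k} :=
      measureReal_mono fun ω hω => hω.2
    have h3 : 0 ≤ (θ' k - θ k) ^ 2 / (2 * (v : ℝ)) := by positivity
    rw [h1]
    nlinarith
  have haux : ∑ s : Fin T, ∑ m : Fin (H k s), P.real (observed π H k t (.inr ⟨s, m⟩)) *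
      ∫ r, l (.inr ⟨s, m⟩) r ∂(obsLaw H k v w (θ k) (.inr ⟨s, m⟩)) =
      -((θ' k - θ k) ^ 2 / (2 * w) * ∑ s ∈ Finset.Iic t, (H k s : ℝ)) := by
    have h1 : ∀ (s : Fin T) (m : Fin (H k s)),
        ∫ r, l (.inr ⟨s, m⟩) r ∂(obsLaw H k v w (θ k) (.inr ⟨s, m⟩)) =
          -((θ' k - θ k) ^ 2 / (2 * w)) := fun s m => integral_gaussianLogRatio w (θ k) (θ' k)
    have h2 : ∀ (s : Fin T) (m : Fin (H k s)), P.real (observed π H k t (.inr ⟨s, m⟩)) =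
        if s ≤ t then 1 else 0 := by
      intro s m
      by_cases hs : s ≤ t <;> simp [observed, hs]
    simp_rw [h1, h2]
    rw [← Finset.filter_ge_eq_Iic, Finset.sum_filter, Finset.mul_sum, ← Finset.sum_neg_distrib]
    refine Finset.sum_congr rfl fun s _ => ?_
    by_cases hs : s ≤ t <;> simp [hs]
    ring
  rw [haux]
  linarith

end Testing

/-! ### Gaussian problems belong to the class -/

section Problems

theorem isSubGaussian_of_map_eq {f : ℝ → ℝ} (hf : Measurable f) {ν : ProbabilityMeasure ℝ} {a : ℝ}
    {v : ℝ≥0} (h : (ν : Measure ℝ).map f = gaussianReal a v) :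
    IsSubGaussian f v ν ∧ ∫ y, f y ∂(ν : Measure ℝ) = a := by
  have hmean : ∫ y, f y ∂(ν : Measure ℝ) = a := by
    rw [← integral_map (f := fun x => x) hf.aemeasurable measurable_id.aestronglyMeasurable, h,
      integral_id_gaussianReal]
  refine ⟨?_, hmean⟩
  unfold IsSubGaussian
  rw [hmean]
  have hmap : (ν : Measure ℝ).map (fun x => f x - a) = gaussianReal 0 v := by
    have := gaussianReal_map_sub_const (μ := a) (v := v) a
    rw [← h, Measure.map_map (by fun_prop) hf, sub_self] at this
    exact this
  refine ⟨fun t => ?_, fun t => ?_⟩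
  · have hi := integrable_exp_mul_gaussianReal (μ := 0) (v := v) t
    rw [← hmap] at hi
    exact hi.comp_measurable (by fun_prop)
  · rw [mgf_gaussianReal hmap]
    simp

theorem bestMean_gaussianProfile {θ : Fin K → ℝ} (v : ℝ≥0) {b : Fin K} (hb : ∀ k, θ k ≤ θ b) :
    bestMean (gaussianProfile θ v) = θ b := by
  unfold bestMean
  simp_rw [mean_gaussianProfile]
  have : Nonempty (Fin K) := ⟨b⟩
  exact le_antisymm (ciSup_le hb) (le_ciSup (Set.finite_range θ).bddAbove b)

theorem gap_gaussianProfile {θ : Fin K → ℝ} (v : ℝ≥0) {b : Fin K} (hb : ∀ k, θ k ≤ θ b)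
    (k : Fin K) : gap (gaussianProfile θ v) k = θ b - θ k := by
  rw [gap, bestMean_gaussianProfile v hb, mean_gaussianProfile]

theorem isProblem_gaussianProfile {σ σaux : ℝ≥0} {φ : Fin K → ℝ → ℝ}
    (hφ : ∀ k, Measurable (φ k)) {Vaux : Fin K → Set (ProbabilityMeasure ℝ)} {Δ : ℝ} (hΔ : 0 < Δ)
    {Δmax : EReal} (hmax : ((2 * Δ : ℝ) : EReal) ≤ Δmax) {θ : Fin K → ℝ}
    {ρ : Fin K → ProbabilityMeasure ℝ} (hρV : ∀ k, ρ k ∈ Vaux k)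
    (hρ : ∀ k, (ρ k : Measure ℝ).map (φ k) = gaussianReal (θ k) (σaux ^ 2)) (b : Fin K)
    (hge : ∀ k, k ≠ b → Δ ≤ θ b - θ k) (hle : ∀ k, θ b - θ k ≤ 2 * Δ) :
    IsProblem σ σaux φ Vaux Δ Δmax (gaussianProfile θ (σ ^ 2), ρ) := by
  have hb : ∀ k, θ k ≤ θ b := by
    intro k
    by_cases hk : k = b
    · rw [hk]
    · linarith [hge k hk]
  have hgap := gap_gaussianProfile (θ := θ) (σ ^ 2) hb
  refine ⟨fun k => ?_, hρV, fun k => (isSubGaussian_of_map_eq (hφ k) (hρ k)).1, fun k => ?_,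
    ⟨b, ?_, fun k hk => ?_⟩, fun k => ?_⟩
  · exact (isSubGaussian_of_map_eq measurable_id Measure.map_id).1
  · rw [(isSubGaussian_of_map_eq (hφ k) (hρ k)).2, mean_gaussianProfile]
  · rw [hgap, sub_self]
  · rw [hgap]
    exact hge k hk
  · rw [hgap]
    exact (EReal.coe_le_coe_iff.2 (hle k)).trans hmax

end Problems

/-! ### The tradeoff between exploration and error -/

section Optimization

/-- Leaving out the smallest of at least two terms costs at most a factor `2`, if the sum is
nonnegative. -/
theorem sum_le_two_mul_sum_erase {L : Fin K → ℝ} (hK : 2 ≤ K) {b : Fin K} (hb : ∀ k, L b ≤ L k)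
    (h0 : 0 ≤ ∑ k, L k) : ∑ k, L k ≤ 2 * ∑ k ∈ Finset.univ.erase b, L k := by
  have hsplit := Finset.add_sum_erase Finset.univ L (Finset.mem_univ b)
  have hK' : (2 : ℝ) ≤ K := by exact_mod_cast hK
  have havg : (K : ℝ) * L b ≤ ∑ k, L k := by
    calc (K : ℝ) * L b = ∑ _k : Fin K, L b := by simp
      _ ≤ _ := Finset.sum_le_sum fun k _ => hb k
  rcases le_total (L b) 0 with h | h
  · linarith
  · nlinarith

/-- The minimum of the right-hand side over `n` is the left-hand side plus `1 / (c * Δ)`. -/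
theorem log_le_add_mul_exp {c Δ S n : ℝ} (hc : 0 < c) (hΔ : 0 < Δ) (hS : 0 < S) {κ : ℝ}
    (hκ : 0 < κ) :
    1 / (c * Δ) * Real.log (c * Real.exp (-1) * Δ ^ 2 / κ * S) ≤
      Δ * n + 1 / κ * (Δ * (Real.exp (-(c * Δ ^ 2 * n) - 1) * S)) := by
  have hpos : 0 < c * Real.exp (-1) * Δ ^ 2 / κ * S := by positivity
  have h := Real.add_one_le_exp (Real.log (c * Real.exp (-1) * Δ ^ 2 / κ * S) - c * Δ ^ 2 * n)
  rw [sub_eq_add_neg, Real.exp_add, Real.exp_log hpos] at h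
  have hexp : Real.exp (-(c * Δ ^ 2 * n) - 1) = Real.exp (-1) * Real.exp (-(c * Δ ^ 2 * n)) := by
    rw [← Real.exp_add]; congr 1; ring
  have hrw : Δ * n + 1 / κ * (Δ * (Real.exp (-(c * Δ ^ 2 * n) - 1) * S)) = 1 / (c * Δ) *
      (c * Δ ^ 2 * n +
        c * Real.exp (-1) * Δ ^ 2 / κ * S * Real.exp (-(c * Δ ^ 2 * n))) := by
    rw [hexp]
    field_simp
  rw [hrw]
  exact mul_le_mul_of_nonneg_left (by linarith) (by positivity)

/-- `halt` says that a policy that explores arm `k` little, i.e. with a small `n k`, has a large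
regret, and `hbase` that exploration is costly; the logarithms come from the best compromise. -/
theorem sum_log_le_of_tradeoff {c Δ R : ℝ} (hc : 0 < c) (hΔ : 0 < Δ) (hR : 0 ≤ R) (hK : 2 ≤ K)
    {S n : Fin K → ℝ} (hS : ∀ k, 0 < S k) {b : Fin K} (hb : ∀ k, S b ≤ S k)
    (hbase : Δ * ∑ k ∈ Finset.univ.erase b, n k ≤ R)
    (halt : ∀ k, k ≠ b → Δ * (Real.exp (-(c * Δ ^ 2 * n k) - 1) * S k) ≤ Δ * n k + R) :
    1 / (4 * c) / Δ * ∑ k, Real.log (c * Real.exp (-1) * Δ ^ 2 / K * S k) ≤ R := by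
  have hK0 : (0 : ℝ) < K := by
    have : 0 < K := by omega
    exact_mod_cast this
  -- a negative bound is trivial, and omitting arm `b` needs a nonnegative sum
  rcases lt_or_ge (∑ k, Real.log (c * Real.exp (-1) * Δ ^ 2 / K * S k)) 0 with hneg | hpos
  · exact (mul_nonpos_of_nonneg_of_nonpos (by positivity) hneg.le).trans hR
  have havg := sum_le_two_mul_sum_erase hK (b := b) (fun k => by
    have := hS b
    have := hb k
    exact Real.log_le_log (by positivity) (by gcongr)) hpos
  have hcard : ((Finset.univ.erase b).card : ℝ) = K - 1 := by
    rw [Finset.card_erase_of_mem (Finset.mem_univ b), Finset.card_univ, Fintype.card_fin,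
      Nat.cast_sub (by omega), Nat.cast_one]
  have h1 : ∑ k ∈ Finset.univ.erase b, Δ * (Real.exp (-(c * Δ ^ 2 * n k) - 1) * S k) ≤
      K * R := by
    calc _ ≤ ∑ k ∈ Finset.univ.erase b, (Δ * n k + R) :=
          Finset.sum_le_sum fun k hk => halt k (Finset.ne_of_mem_erase hk)
      _ = Δ * ∑ k ∈ Finset.univ.erase b, n k + (K - 1) * R := by
          rw [Finset.sum_add_distrib, ← Finset.mul_sum, Finset.sum_const, nsmul_eq_mul, hcard]
      _ ≤ _ := by linarith
  have h2 : 1 / (K : ℝ) * ∑ k ∈ Finset.univ.erase b,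
      Δ * (Real.exp (-(c * Δ ^ 2 * n k) - 1) * S k) ≤ R := by
    calc _ ≤ 1 / (K : ℝ) * (K * R) := mul_le_mul_of_nonneg_left h1 (by positivity)
      _ = R := by field_simp
  have h3 : 1 / (c * Δ) * ∑ k ∈ Finset.univ.erase b,
      Real.log (c * Real.exp (-1) * Δ ^ 2 / K * S k) ≤ 2 * R := by
    calc _ = ∑ k ∈ Finset.univ.erase b,
          1 / (c * Δ) * Real.log (c * Real.exp (-1) * Δ ^ 2 / K * S k) := Finset.mul_sum _ _ _
      _ ≤ ∑ k ∈ Finset.univ.erase b,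
          (Δ * n k + 1 / K * (Δ * (Real.exp (-(c * Δ ^ 2 * n k) - 1) * S k))) :=
          Finset.sum_le_sum fun k _ => log_le_add_mul_exp hc hΔ (hS k) hK0
      _ = Δ * ∑ k ∈ Finset.univ.erase b, n k + 1 / (K : ℝ) * ∑ k ∈ Finset.univ.erase b,
          Δ * (Real.exp (-(c * Δ ^ 2 * n k) - 1) * S k) := by
          rw [Finset.sum_add_distrib, ← Finset.mul_sum, ← Finset.mul_sum]
      _ ≤ _ := by linarith
  calc _ ≤ 1 / (4 * c) / Δ * (2 * ∑ k ∈ Finset.univ.erase b,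
        Real.log (c * Real.exp (-1) * Δ ^ 2 / K * S k)) :=
        mul_le_mul_of_nonneg_left havg (by positivity)
    _ = 1 / 2 * (1 / (c * Δ) * ∑ k ∈ Finset.univ.erase b,
        Real.log (c * Real.exp (-1) * Δ ^ 2 / K * S k)) := by
        field_simp
        ring
    _ ≤ R := by linarith

end Optimization

/-! ### The regret in the base and the alternative problems -/

section Regret

theorem mul_sum_choice_le_regret {φ : Fin K → ℝ → ℝ} (hφ : ∀ k, Measurable (φ k))
    (H : Fin K → Fin T → ℕ) (π : Policy K T) (v w : ℝ≥0) {θ : Fin K → ℝ}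
    {ρ : Fin K → ProbabilityMeasure ℝ}
    (hρ : ∀ k, (ρ k : Measure ℝ).map (φ k) = gaussianReal (θ k) w) {Δ : ℝ} {b : Fin K}
    (hb : ∀ k, θ k ≤ θ b) (hge : ∀ k, k ≠ b → Δ ≤ θ b - θ k) :
    Δ * ∑ k ∈ Finset.univ.erase b, ∑ t, (gaussianModel π H v w θ).real {ω | choice π H t ω = k} ≤
      regret φ H π (gaussianProfile θ v, ρ) := by
  rw [regret_eq_sum φ hφ H π v w θ ρ hρ, Finset.sum_comm (s := Finset.univ.erase b),
    Finset.mul_sum]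
  refine Finset.sum_le_sum fun t _ => ?_
  rw [Finset.mul_sum, ← Finset.add_sum_erase _ _ (Finset.mem_univ b)]
  simp_rw [gap_gaussianProfile v hb]
  rw [sub_self, zero_mul, zero_add]
  exact Finset.sum_le_sum fun k hk =>
    mul_le_mul_of_nonneg_right (hge k (Finset.ne_of_mem_erase hk)) measureReal_nonneg

theorem real_choice_ne_le (H : Fin K → Fin T → ℕ) (π : Policy K T) (v w : ℝ≥0) (θ : Fin K → ℝ)
    (b : Fin K) (t : Fin T) :
    (gaussianModel π H v w θ).real {ω | choice π H t ω ≠ b} ≤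
      ∑ k ∈ Finset.univ.erase b, (gaussianModel π H v w θ).real {ω | choice π H t ω = k} := by
  refine (measureReal_mono (fun ω hω => ?_) (measure_ne_top _ _)).trans
    (measureReal_biUnion_finset_le _ _)
  simpa using hω

/-- The lower bound for a real upper bound `R` of the regret over the class. -/
theorem le_of_forall_regret_le {σ σaux : ℝ≥0} (hσ : 0 < σ) (hσaux : 0 < σaux) (hK : 2 ≤ K)
    (hT : 1 ≤ T) {Δ : ℝ} (hΔ : 0 < Δ) {Δmax : EReal} (hmax : ((2 * Δ : ℝ) : EReal) ≤ Δmax)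
    {φ : Fin K → ℝ → ℝ} (hφ : ∀ k, Measurable (φ k)) {Vaux : Fin K → Set (ProbabilityMeasure ℝ)}
    (hV : ∀ (k : Fin K) (a : ℝ), ∃ ρ ∈ Vaux k,
      (ρ : Measure ℝ).map (φ k) = gaussianReal a (σaux ^ 2))
    (H : Fin K → Fin T → ℕ) (π : Policy K T) {R : ℝ}
    (hreg : ∀ p, IsProblem σ σaux φ Vaux Δ Δmax p → regret φ H π p ≤ R) :
    1 / (4 * (2 / (σ : ℝ) ^ 2)) / Δ * ∑ k : Fin K,
      Real.log (2 / (σ : ℝ) ^ 2 * Real.exp (-1) * Δ ^ 2 / K *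
        ∑ t : Fin T, Real.exp (-(2 / (σaux : ℝ) ^ 2 * Δ ^ 2 * ∑ s ∈ Finset.Iic t, (H k s : ℝ)))) ≤
      R := by
  have hσ' : (0 : ℝ) < σ := hσ
  have hσaux' : (0 : ℝ) < σaux := hσaux
  have hv : σ ^ 2 ≠ 0 := by positivity
  have hw : σaux ^ 2 ≠ 0 := by positivity
  choose ρ hρV hρ using hV
  have hne : Nonempty (Fin K) := ⟨⟨0, by omega⟩⟩
  have hneT : Nonempty (Fin T) := ⟨⟨0, by omega⟩⟩
  set S : Fin K → ℝ := fun k => ∑ t : Fin T,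
    Real.exp (-(2 / (σaux : ℝ) ^ 2 * Δ ^ 2 * ∑ s ∈ Finset.Iic t, (H k s : ℝ))) with hS
  obtain ⟨b, hb⟩ := Finite.exists_min S
  -- arm `b` is the best one of the base problem
  let θ : Fin K → ℝ := Function.update (fun _ => 0) b Δ
  have hθb : θ b = Δ := Function.update_self _ _ _
  have hθ : ∀ k, k ≠ b → θ k = 0 := fun k hk => Function.update_of_ne hk _ _
  have hθle : ∀ k, θ k ≤ θ b := by
    intro k
    by_cases hk : k = b
    · rw [hk]
    · rw [hθ k hk, hθb]; exact hΔ.le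
  have hθge : ∀ k, k ≠ b → Δ ≤ θ b - θ k := fun k hk => by rw [hθ k hk, hθb, sub_zero]
  have hbase : Δ * ∑ k ∈ Finset.univ.erase b,
      ∑ t, (gaussianModel π H (σ ^ 2) (σaux ^ 2) θ).real {ω | choice π H t ω = k} ≤ R :=
    (mul_sum_choice_le_regret hφ H π _ _ (fun k => hρ k (θ k)) hθle hθge).trans
      (hreg _ (isProblem_gaussianProfile hφ hΔ hmax (fun k => hρV k (θ k))
        (fun k => hρ k (θ k)) b hθge fun k => by
          by_cases hk : k = b
          · rw [hk, sub_self]; positivity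
          · rw [hθ k hk, hθb]; linarith))
  have hn : ∀ k, 0 ≤ ∑ t,
      (gaussianModel π H (σ ^ 2) (σaux ^ 2) θ).real {ω | choice π H t ω = k} :=
    fun k => Finset.sum_nonneg fun t _ => measureReal_nonneg
  have hR : 0 ≤ R := le_trans (mul_nonneg hΔ.le (Finset.sum_nonneg fun k _ => hn k)) hbase
  refine sum_log_le_of_tradeoff (by positivity) hΔ hR hK
    (fun k => Finset.sum_pos (fun t _ => Real.exp_pos _) Finset.univ_nonempty) hb hbase ?_
  intro k hk
  -- arm `k` is the best one of the alternative problem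
  let θ' : Fin K → ℝ := Function.update θ k (2 * Δ)
  have hθ'k : θ' k = 2 * Δ := Function.update_self _ _ _
  have hθ' : ∀ j, j ≠ k → θ' j = θ j := fun j hj => Function.update_of_ne hj _ _
  have hθ'bd : ∀ j, j ≠ k → 0 ≤ θ' j ∧ θ' j ≤ Δ := by
    intro j hj
    rw [hθ' j hj]
    by_cases hjb : j = b
    · rw [hjb, hθb]; exact ⟨hΔ.le, le_rfl⟩
    · rw [hθ j hjb]; exact ⟨le_rfl, hΔ.le⟩
  have hθ'ge : ∀ j, j ≠ k → Δ ≤ θ' k - θ' j := fun j hj => by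
    rw [hθ'k]; linarith [(hθ'bd j hj).2]
  have hθ'le : ∀ j, θ' j ≤ θ' k := by
    intro j
    by_cases hj : j = k
    · rw [hj]
    · linarith [hθ'ge j hj]
  have halt : Δ * ∑ t, (gaussianModel π H (σ ^ 2) (σaux ^ 2) θ').real {ω | choice π H t ω ≠ k} ≤
      R := by
    refine le_trans (mul_le_mul_of_nonneg_left ?_ hΔ.le)
      ((mul_sum_choice_le_regret hφ H π _ _ (fun k => hρ k (θ' k)) hθ'le hθ'ge).trans
      (hreg _ (isProblem_gaussianProfile hφ hΔ hmax (fun k => hρV k (θ' k))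
        (fun k => hρ k (θ' k)) k hθ'ge fun j => by
          by_cases hj : j = k
          · rw [hj, sub_self]; positivity
          · rw [hθ'k]; linarith [(hθ'bd j hj).1])))
    rw [Finset.sum_comm (s := Finset.univ.erase k)]
    exact Finset.sum_le_sum fun t _ => real_choice_ne_le H π _ _ θ' k t
  have htest : Real.exp (-(2 / (σ : ℝ) ^ 2 * Δ ^ 2 *
        ∑ s, (gaussianModel π H (σ ^ 2) (σaux ^ 2) θ).real {ω | choice π H s ω = k}) - 1) * S k ≤
      ∑ t, (gaussianModel π H (σ ^ 2) (σaux ^ 2) θ).real {ω | choice π H t ω = k} +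
        ∑ t, (gaussianModel π H (σ ^ 2) (σaux ^ 2) θ').real {ω | choice π H t ω ≠ k} := by
    rw [hS, Finset.mul_sum, ← Finset.sum_add_distrib]
    refine Finset.sum_le_sum fun t _ => ?_
    refine le_trans (le_of_eq ?_) (exp_le_choice_add_choice_ne π H k hv hw hθ' t)
    rw [← Real.exp_add, hθ'k, hθ k hk]
    congr 1
    push_cast
    field_simp
    ring
  calc _ ≤ Δ * (_ + _) := mul_le_mul_of_nonneg_left htest hΔ.le
    _ ≤ _ := by rw [mul_add]; linarith

end Regret

end AuxBandit

theorem theorem1 (σ σaux : ℝ≥0) (hσ : 0 < σ) (hσaux : 0 < σaux) :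
    ∃ C₁ C₂ C₃ : ℝ, 0 < C₁ ∧ 0 < C₂ ∧ 0 < C₃ ∧
      ∀ (K T : ℕ) (_ : 2 ≤ K) (_ : 1 ≤ T)
        (Δ : ℝ) (_ : 0 < Δ) (Δmax : EReal) (_ : ((2 * Δ : ℝ) : EReal) ≤ Δmax)
        (φ : Fin K → ℝ → ℝ) (_ : ∀ k, Measurable (φ k))
        (Vaux : Fin K → Set (ProbabilityMeasure ℝ))
        (_ : ∀ (k : Fin K) (a : ℝ), ∃ ρ ∈ Vaux k,
          (ρ : Measure ℝ).map (φ k) = gaussianReal a (σaux ^ 2))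
        (H : Fin K → Fin T → ℕ) (π : AuxBandit.Policy K T),
        ((C₁ / Δ * ∑ k : Fin K, Real.log (C₂ * Δ ^ 2 / K *
            ∑ t : Fin T, Real.exp (-(C₃ * Δ ^ 2 * ∑ s ∈ Finset.Iic t, (H k s : ℝ)))) : ℝ) : EReal)
          ≤ AuxBandit.worstCaseRegret σ σaux φ Vaux Δ Δmax H π := by
  have hσ' : (0 : ℝ) < σ := hσ
  have hσaux' : (0 : ℝ) < σaux := hσaux
  refine ⟨1 / (4 * (2 / (σ : ℝ) ^ 2)), 2 / (σ : ℝ) ^ 2 * Real.exp (-1), 2 / (σaux : ℝ) ^ 2,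
    by positivity, by positivity, by positivity, ?_⟩
  intro K T hK hT Δ hΔ Δmax hmax φ hφ Vaux hV H π
  refine EReal.le_of_forall_lt_iff_le.1 fun R hR => EReal.coe_le_coe_iff.2 ?_
  refine AuxBandit.le_of_forall_regret_le hσ hσaux hK hT hΔ hmax hφ hV H π fun p hp => ?_
  have hle : ((AuxBandit.regret φ H π p : ℝ) : EReal) ≤
      AuxBandit.worstCaseRegret σ σaux φ Vaux Δ Δmax H π :=
    le_iSup (fun p : {p // AuxBandit.IsProblem σ σaux φ Vaux Δ Δmax p} =>
      ((AuxBandit.regret φ H π p.1 : ℝ) : EReal)) ⟨p, hp⟩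
  exact (EReal.coe_lt_coe_iff.1 (hle.trans_lt hR)).le
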